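/- Let $\lambda_s,\mu_s,\sigma_s,\mu_v,\beta_v,\gamma_v,\sigma_v,\rho_{sv},S_0,V_0$ be real constants. On a probability space let $W_s$ and $W_v$ be standard Brownian motions with instantaneous correlation $\rho_{sv}$, that is, $(W_s,W_v)$ is jointly Gaussian with $\mathrm{Cov}(W_{s,r},W_{v,t})=\rho_{sv}\min(r,t)$ for all $r,t\ge 0$ (so that $\mathrm{corr}(dW_{s,t},dW_{v,t})=\rho_{sv}$). Let $S$ and $V$ be processes with almost surely continuous paths, started at the constants $S_0$ and $V_0$, that solve $$dS_t=\lambda_s(\mu_s-S_t)\,dt+\sigma_s\,dW_{s,t},\qquad dV_t=\bigl(\mu_v+\beta_v(S_t-\mu_s)^2-\gamma_vV_t\bigr)\,dt+\sigma_v\,dW_{v,t}.$$ Then for every $t\ge 0$ all the expectations below are of integrable random variables, the integrand on the right-hand side is integrable on $[0,t]$, and $$\mathbb{E}[S_t^2V_t]=e^{-(\gamma_v+2\lambda_s)t}S_0^2V_0+\int_0^t e^{(\gamma_v+2\lambda_s)(u-t)}\Bigl(2\sigma_v\sigma_s\rho_{sv}\,\mathbb{E}[S_u]+[\mu_v+\beta_v\mu_s^2]\,\mathbb{E}[S_u^2]-2\mu_s\beta_v\,\mathbb{E}[S_u^3]+\beta_v\,\mathbb{E}[S_u^4]+2\lambda_s\mu_s\,\mathbb{E}[S_uV_u]+\sigma_s^2\,\mathbb{E}[V_u]\Bigr)\,du.$$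 -/

import Mathlib

open MeasureTheory ProbabilityTheory
open scoped NNReal

/-- A pair of real Brownian motions with instantaneous correlation `ρ`, that is,
`corr(dB_t, dW_t) = ρ`: both components are standard Brownian motions, the pair is jointly
Gaussian, and `Cov(B_s, W_t) = ρ · min(s, t)` for all times `s` and `t`. Equivalently, `(B, W)` is
a planar Brownian motion with covariance matrix `[[1, ρ], [ρ, 1]]` per unit of time. -/
structure IsCorrelatedBrownianPair {Ω : Type*} {mΩ : MeasurableSpace Ω} (ρ : ℝ)
    (B W : ℝ≥0 → Ω → ℝ) (P : Measure Ω) : Prop where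
  fst : IsBrownianReal B P
  snd : IsBrownianReal W P
  gaussian : IsGaussianProcess (Sum.elim B W : ℝ≥0 ⊕ ℝ≥0 → Ω → ℝ) P
  cov_eq : ∀ s t : ℝ≥0, cov[B s, W t; P] = ρ * (min s t : ℝ≥0)

/-- The process `X` solves the stochastic differential equation with additive noise
`dX_t = b_t dt + σ dW_t`, `X_0 = x₀`, where the drift `b` is a process that may depend on `X`:
almost surely, the paths of `X` and of `b` are continuous and
`X_t = x₀ + ∫₀ᵗ b_u du + σ W_t` for all `t ≥ 0`. As `σ` is constant, the stochastic integral
`∫₀ᵗ σ dW_u` is `σ W_t` (recall `W_0 = 0`). The point `u ∈ [0, t]` of the real line is read as a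
time through `Real.toNNReal`. -/
structure IsAdditiveNoiseSolution {Ω : Type*} {mΩ : MeasurableSpace Ω} (x₀ : ℝ)
    (b : ℝ≥0 → Ω → ℝ) (σ : ℝ) (W X : ℝ≥0 → Ω → ℝ) (P : Measure Ω) : Prop where
  cont : ∀ᵐ ω ∂P, Continuous (X · ω)
  drift_cont : ∀ᵐ ω ∂P, Continuous (b · ω)
  eqn : ∀ᵐ ω ∂P, ∀ t : ℝ≥0,
    X t ω = x₀ + (∫ u in (0 : ℝ)..t, b u.toNNReal ω) + σ * W t ω

/-- The sentiment process `S` and the volatility process `V` of the sentiment-driven stochastic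
volatility model, started at the constants `S₀` and `V₀`:
`dS_t = λ_s (μ_s - S_t) dt + σ_s dW_{s,t}`,
`dV_t = (μ_v + β_v (S_t - μ_s)² - γ_v V_t) dt + σ_v dW_{v,t}`,
with `corr(dW_{s,t}, dW_{v,t}) = ρ_{sv}`. -/
structure IsSentimentVolatility {Ω : Type*} {mΩ : MeasurableSpace Ω}
    (lam_s mu_s sigma_s mu_v beta_v gamma_v sigma_v rho_sv S₀ V₀ : ℝ)
    (Ws Wv S V : ℝ≥0 → Ω → ℝ) (P : Measure Ω) : Prop where
  noise : IsCorrelatedBrownianPair rho_sv Ws Wv P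
  sentiment : IsAdditiveNoiseSolution S₀ (fun t ω ↦ lam_s * (mu_s - S t ω)) sigma_s Ws S P
  volatility : IsAdditiveNoiseSolution V₀
    (fun t ω ↦ mu_v + beta_v * (S t ω - mu_s) ^ 2 - gamma_v * V t ω) sigma_v Wv V P

open Filter Topology

/-! Write `m t = E[S_t² V_t]` and `k = gamma_v + 2 * lam_s`. Itô's formula suggests `m' = F - k m`,
where `F` is the bracket under the integral, and variation of constants then gives the claim. The
noise is additive, so no stochastic calculus is needed: the right derivative of `m` is computed
directly.

Over `[t, s]` each process moves by a drift integral plus a constant multiple of a Brownian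
increment. The drift integrals contribute the classical product rule, by dominated convergence
(`tendsto_integral_drift_part`). With only the noise increments added, the product is expanded:
these increments are independent of `S_t` and `V_t`, so the linear terms vanish, the quadratic ones
give the Itô correction `σ² E[Y] + 2στρ E[X]`, and the cubic one is `O(h^{3/2})`
(`integral_sq_mul_add_noise`, `exists_abs_integral_increment_sq_mul_le`). A right derivative
suffices, since `m` is continuous.

Two facts must be supplied. Running suprema need moments of all orders: for Brownian motion this
comes from dyadic chaining. And `S_t`, `V_t` must depend only on the noise up to `t`: the drifts are
linear in the unknown, so `eq_exp_mul_of_linear_drift` solves each equation explicitly in terms of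
the noise, which transfers both adaptedness and moments. `RegularProcess` packages these properties.
-/

theorem integral_abs_pow_gaussianReal (n : ℕ) (v : ℝ≥0) :
    ∫ x, |x| ^ n ∂(gaussianReal 0 v) = √v ^ n * ∫ x, |x| ^ n ∂(gaussianReal 0 1) := by
  have h := gaussianReal_map_const_mul (μ := 0) (v := 1) (√(v : ℝ))
  have hv : (NNReal.mk (√(v : ℝ) ^ 2) (sq_nonneg _) * 1 : ℝ≥0) = v := by
    ext; simp
  rw [mul_zero, hv] at h
  rw [← h, integral_map (by fun_prop) (by fun_prop)]
  simp_rw [abs_mul, mul_pow, abs_of_nonneg (Real.sqrt_nonneg _)]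
  rw [integral_const_mul]

/-! ### Moments of Brownian increments. -/

section Brownian

variable {Ω : Type*} {mΩ : MeasurableSpace Ω} {P : Measure Ω} {W : ℝ≥0 → Ω → ℝ}

theorem ProbabilityTheory.IsPreBrownianReal.memLp (hW : IsPreBrownianReal W P) (t : ℝ≥0) (p : ℕ) :
    MemLp (W t) p P :=
  (hW.isGaussianProcess.hasGaussianLaw_eval t).memLp (by simp)

theorem ProbabilityTheory.IsPreBrownianReal.memLp_sub (hW : IsPreBrownianReal W P) (s t : ℝ≥0)
    (p : ℕ) : MemLp (fun ω ↦ W s ω - W t ω) p P :=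
  (hW.memLp s p).sub (hW.memLp t p)

theorem ProbabilityTheory.IsPreBrownianReal.integral_abs_sub_pow (hW : IsPreBrownianReal W P)
    (s t : ℝ≥0) (n : ℕ) :
    ∫ ω, |W s ω - W t ω| ^ n ∂P
      = √(|(s : ℝ) - t|) ^ n * ∫ x, |x| ^ n ∂(gaussianReal 0 1) := by
  have h := (hW.hasLaw_sub s t).integral_comp (f := fun x : ℝ ↦ |x| ^ n) (by fun_prop)
  rw [integral_abs_pow_gaussianReal] at h
  simpa [Function.comp_def, NNReal.dist_eq, Real.dist_eq] using h

end Brownian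

/-! ### Joint increments and their independence from the past. -/

section Pair

variable {Ω : Type*} {mΩ : MeasurableSpace Ω} {P : Measure Ω} {ρ : ℝ} {B W : ℝ≥0 → Ω → ℝ}

/-- A pair of processes stopped at time `t`. -/
def pastPair (B W : ℝ≥0 → Ω → ℝ) (t : ℝ≥0) (ω : Ω) : ℝ≥0 ⊕ ℝ≥0 → ℝ :=
  Sum.elim (fun s ↦ B (min t s) ω) (fun s ↦ W (min t s) ω)

/-- The increments of a pair of processes between `t` and `t + h`. -/
def incrementPair (B W : ℝ≥0 → Ω → ℝ) (t h : ℝ≥0) (ω : Ω) : Bool → ℝ :=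
  fun b ↦ cond b (B (t + h) ω - B t ω) (W (t + h) ω - W t ω)

namespace IsCorrelatedBrownianPair

theorem integral_increment_mul (hBW : IsCorrelatedBrownianPair ρ B W P) (t h : ℝ≥0) :
    ∫ ω, (B (t + h) ω - B t ω) * (W (t + h) ω - W t ω) ∂P = ρ * h := by
  have := hBW.gaussian.isProbabilityMeasure
  have hB := hBW.fst.toIsPreBrownianReal
  have hW := hBW.snd.toIsPreBrownianReal
  have mB t : MemLp (B t) 2 P := hB.memLp t 2
  have mW t : MemLp (W t) 2 P := hW.memLp t 2
  have key := covariance_eq_sub ((mB (t + h)).sub (mB t)) ((mW (t + h)).sub (mW t))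
  rw [covariance_sub_left (mB _) (mB _) ((mW _).sub (mW _)),
    covariance_sub_right (mB _) (mW _) (mW _), covariance_sub_right (mB _) (mW _) (mW _)] at key
  simp only [hBW.cov_eq] at key
  have h0 : ∫ ω, (B (t + h) - B t) ω ∂P = 0 := by
    simp only [Pi.sub_apply]
    rw [integral_sub (hB.integrable_eval _) (hB.integrable_eval _)]
    simp [hB.integral_eval]
  rw [h0, zero_mul, sub_zero] at key
  simp only [min_self, le_add_iff_nonneg_right, zero_le, min_eq_left, min_eq_right,
    NNReal.coe_add] at key
  simp only [Pi.mul_apply, Pi.sub_apply] at key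
  rw [← key]; ring

/-- Increments and past are jointly Gaussian, so vanishing covariances suffice. All covariances are
multiples of a minimum of times, and a time `min t s` has the same minimum with `t + h` as with `t`.
-/
theorem indepFun_increment_past (hBW : IsCorrelatedBrownianPair ρ B W P) (t h : ℝ≥0) :
    IndepFun (incrementPair B W t h) (pastPair B W t) P := by
  have := hBW.gaussian.isProbabilityMeasure
  have hB := hBW.fst.toIsPreBrownianReal
  have hW := hBW.snd.toIsPreBrownianReal
  have aB t : AEMeasurable (B t) P := hB.aemeasurable t
  have aW t : AEMeasurable (W t) P := hW.aemeasurable t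
  have mB t : MemLp (B t) 2 P := hB.memLp t 2
  have mW t : MemLp (W t) 2 P := hW.memLp t 2
  have key := IsGaussianProcess.indepFun_of_covariance_eq_zero (P := P)
    (X := fun (b : Bool) ω ↦ incrementPair B W t h ω b)
    (Y := fun (s : ℝ≥0 ⊕ ℝ≥0) ω ↦ pastPair B W t ω s) ?_ ?_ ?_ ?_
  · exact key
  · refine hBW.gaussian.of_isGaussianProcess ?_
    rintro ((_ | _) | (s | s))
    · exact ⟨{.inr t, .inr (t + h)},
        { toFun x := x ⟨.inr (t + h), by simp⟩ - x ⟨.inr t, by simp⟩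
          map_add' x y := by simp; abel
          map_smul' c x := by simp; ring }, by simp [incrementPair]⟩
    · exact ⟨{.inl t, .inl (t + h)},
        { toFun x := x ⟨.inl (t + h), by simp⟩ - x ⟨.inl t, by simp⟩
          map_add' x y := by simp; abel
          map_smul' c x := by simp; ring }, by simp [incrementPair]⟩
    · exact ⟨{.inl (min t s)}, .proj ⟨.inl (min t s), by simp⟩, by simp [pastPair]⟩
    · exact ⟨{.inr (min t s)}, .proj ⟨.inr (min t s), by simp⟩, by simp [pastPair]⟩
  · rintro (_ | _) <;> simp only [incrementPair, cond_true, cond_false] <;> fun_prop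
  · rintro (s | s) <;> simp only [pastPair, Sum.elim] <;> fun_prop
  · have e1 (s : ℝ≥0) : min t (min t s) = min t s := by simp
    have e2 (s : ℝ≥0) : min (t + h) (min t s) = min t s :=
      min_eq_right ((min_le_left t s).trans (by simp))
    rintro (_ | _) (s | s)
    · change cov[W (t + h) - W t, B (min t s); P] = 0
      rw [covariance_sub_left (mW _) (mW _) (mB _), covariance_comm, hBW.cov_eq, covariance_comm,
        hBW.cov_eq, min_comm _ (t + h), e2, min_comm _ t, e1, sub_self]
    · change cov[W (t + h) - W t, W (min t s); P] = 0
      rw [covariance_sub_left (mW _) (mW _) (mW _), hW.covariance_eval, hW.covariance_eval, e1, e2,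
        sub_self]
    · change cov[B (t + h) - B t, B (min t s); P] = 0
      rw [covariance_sub_left (mB _) (mB _) (mB _), hB.covariance_eval, hB.covariance_eval, e1, e2,
        sub_self]
    · change cov[B (t + h) - B t, W (min t s); P] = 0
      rw [covariance_sub_left (mB _) (mB _) (mW _), hBW.cov_eq, hBW.cov_eq, e1, e2, sub_self]

end IsCorrelatedBrownianPair

end Pair

/-! ### Moments of the running supremum by dyadic chaining. -/

/-- The largest multiple of `2⁻ⁿ` that is at most `u`. -/
noncomputable def dyadicFloor (n : ℕ) (u : ℝ≥0) : ℝ≥0 := (⌊2 ^ n * u⌋₊ : ℝ≥0) / 2 ^ n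

theorem tendsto_dyadicFloor (u : ℝ≥0) : Tendsto (fun n ↦ dyadicFloor n u) atTop (𝓝 u) := by
  have := (tendsto_nat_floor_mul_div_atTop (R := ℝ) u.2).comp
    (tendsto_pow_atTop_atTop_of_one_lt (one_lt_two (α := ℝ)))
  rw [← NNReal.tendsto_coe]
  refine this.congr fun n ↦ ?_
  simp only [Function.comp, dyadicFloor, NNReal.coe_div, NNReal.coe_natCast, NNReal.coe_pow,
    NNReal.coe_ofNat]
  congr 2
  have h : ⌊((2 ^ n * u : ℝ≥0) : ℝ)⌋₊ = ⌊2 ^ n * u⌋₊ := Nonneg.nat_floor_coe _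
  rw [← h, mul_comm]
  push_cast
  rfl

/-- Refining the floor by one level either keeps the point or moves it by one cell of level `n + 1`,
so each link of the chain costs at most one dyadic increment. -/
theorem dyadicFloor_succ (n : ℕ) (u : ℝ≥0) :
    ∃ j : ℕ, j ≤ 2 ^ (n + 1) * u ∧ dyadicFloor n u = j / 2 ^ (n + 1) ∧
      (dyadicFloor (n + 1) u = j / 2 ^ (n + 1) ∨
        dyadicFloor (n + 1) u = (j + 1 : ℕ) / 2 ^ (n + 1)) := by
  set k := ⌊2 ^ n * u⌋₊ with hk
  have h1 : (k : ℝ≥0) ≤ 2 ^ n * u := Nat.floor_le (zero_le)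
  have h2 : 2 ^ n * u < k + 1 := Nat.lt_floor_add_one _
  have e : 2 ^ (n + 1) * u = 2 * (2 ^ n * u) := by ring
  refine ⟨2 * k, ?_, ?_, ?_⟩
  · rw [e]; push_cast; gcongr
  · rw [dyadicFloor, ← hk, pow_succ']; push_cast
    rw [mul_div_mul_left _ _ two_ne_zero]
  · have l : 2 * k ≤ ⌊2 ^ (n + 1) * u⌋₊ := by
      apply Nat.le_floor; rw [e]; push_cast; gcongr
    have r : ⌊2 ^ (n + 1) * u⌋₊ < 2 * k + 2 := by
      rw [Nat.floor_lt (zero_le), e]; push_cast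
      calc 2 * (2 ^ n * u) < 2 * (k + 1) := by gcongr
        _ = _ := by ring
    have : ⌊2 ^ (n + 1) * u⌋₊ = 2 * k ∨ ⌊2 ^ (n + 1) * u⌋₊ = 2 * k + 1 := by omega
    rcases this with h | h
    · left; rw [dyadicFloor, h]
    · right; rw [dyadicFloor, h]

/-- If the increments of `w` over the dyadic intervals of level `n` in `[0, T]` decay geometrically
in `n`, then `w` is bounded on `[0, T]`. -/
theorem abs_le_of_dyadic_increments_le {w : ℝ≥0 → ℝ} (hw : Continuous w) (T : ℕ) {r R : ℝ}
    (hr0 : 0 ≤ r) (hr1 : r < 1) (hR : 0 ≤ R)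
    (h : ∀ n j : ℕ, j ≤ 2 ^ n * T → |w ((j + 1 : ℕ) / 2 ^ n) - w (j / 2 ^ n)| ≤ R * r ^ n)
    {u : ℝ≥0} (hu : u ≤ T) :
    |w u| ≤ ∑ k ∈ Finset.range (T + 1), |w k| + R / (1 - r) := by
  have step n : |w (dyadicFloor (n + 1) u) - w (dyadicFloor n u)| ≤ R * r ^ (n + 1) := by
    obtain ⟨j, hj, h0, h1⟩ := dyadicFloor_succ n u
    have hjT : j ≤ 2 ^ (n + 1) * T := by
      have : (j : ℝ≥0) ≤ 2 ^ (n + 1) * T := hj.trans (by gcongr)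
      exact_mod_cast this
    rcases h1 with h1 | h1
    · rw [h0, h1, sub_self, abs_zero]; positivity
    · rw [h0, h1]; exact h _ _ hjT
  have bound N : |w (dyadicFloor N u)| ≤ |w (dyadicFloor 0 u)| +
      ∑ n ∈ Finset.range N, R * r ^ (n + 1) := by
    induction N with
    | zero => simp
    | succ N ih =>
      rw [Finset.sum_range_succ]
      have := abs_sub_abs_le_abs_sub (w (dyadicFloor (N + 1) u)) (w (dyadicFloor N u))
      linarith [step N]
  have geom N : ∑ n ∈ Finset.range N, R * r ^ (n + 1) ≤ R / (1 - r) := by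
    have e : ∑ n ∈ Finset.range N, R * r ^ (n + 1) ≤ ∑ n ∈ Finset.range N, R * r ^ n := by
      gcongr ∑ n ∈ _, R * ?_ with n _
      exact pow_le_pow_of_le_one hr0 hr1.le (Nat.le_succ n)
    refine e.trans ?_
    rw [← Finset.mul_sum, div_eq_mul_inv, ← tsum_geometric_of_lt_one hr0 hr1]
    gcongr
    exact (summable_geometric_of_lt_one hr0 hr1).sum_le_tsum _ fun _ _ ↦ by positivity
  -- The chain starts at the integer part of `u`, one of `0, …, T`; the finite sum covers every such
  -- start.
  have zero : |w (dyadicFloor 0 u)| ≤ ∑ k ∈ Finset.range (T + 1), |w k| := by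
    have hf : ⌊u⌋₊ ∈ Finset.range (T + 1) := by
      have := Nat.floor_le_floor hu
      rw [Nat.floor_natCast] at this
      simpa using Nat.lt_succ_of_le this
    have : dyadicFloor 0 u = (⌊u⌋₊ : ℝ≥0) := by simp [dyadicFloor]
    rw [this]
    exact Finset.single_le_sum (f := fun k : ℕ ↦ |w k|) (fun _ _ ↦ abs_nonneg _) hf
  refine le_of_tendsto (((hw.tendsto u).comp (tendsto_dyadicFloor u)).abs) ?_
  filter_upwards with N
  have := bound N
  have := geom N
  simp only [Function.comp]
  linarith

/-- A level-`n` increment has variance `2⁻ⁿ`, so its `q`-th absolute moment is `c * 2^(-nq/2)`, at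
most `c * 8⁻ⁿ` because `q ≥ 6`. There are about `2ⁿ T` increments; even with weight `2ⁿ` on each,
the total expectation is dominated by a convergent geometric series. -/
theorem ProbabilityTheory.IsPreBrownianReal.exists_dyadic_increments_le {Ω : Type*}
    {mΩ : MeasurableSpace Ω} {P : Measure Ω} {W : ℝ≥0 → Ω → ℝ} (hW : IsPreBrownianReal W P)
    (T q : ℕ) (hq : 6 ≤ q) :
    ∃ R : Ω → ℝ, MemLp R q P ∧ (∀ ω, 0 ≤ R ω) ∧ ∃ r : ℝ, 0 ≤ r ∧ r < 1 ∧
      ∀ᵐ ω ∂P, ∀ n j : ℕ, j ≤ 2 ^ n * T →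
        |W ((j + 1 : ℕ) / 2 ^ n) ω - W (j / 2 ^ n) ω| ≤ R ω * r ^ n := by
  have hP := hW.isGaussianProcess.isProbabilityMeasure
  have q0 : (q : ℝ) ≠ 0 := by positivity
  set D : ℕ → ℕ → Ω → ℝ := fun n j ω ↦ W ((j + 1 : ℕ) / 2 ^ n) ω - W (j / 2 ^ n) ω with hD
  set c := ∫ x, |x| ^ q ∂(gaussianReal 0 1) with hc
  have c0 : 0 ≤ c := integral_nonneg fun _ ↦ by positivity
  have mD n j : AEMeasurable (D n j) P := (hW.aemeasurable _).sub (hW.aemeasurable _)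
  have ED n j : ∫⁻ ω, ‖D n j ω‖ₑ ^ q ∂P ≤ ENNReal.ofReal (c * (1 / 8) ^ n) := by
    have e1 : ∫⁻ ω, ‖D n j ω‖ₑ ^ q ∂P = ∫⁻ ω, ENNReal.ofReal (|D n j ω| ^ q) ∂P := by
      refine lintegral_congr fun ω ↦ ?_
      rw [ENNReal.ofReal_pow (abs_nonneg _), ← Real.enorm_eq_ofReal_abs]
    rw [e1, ← ofReal_integral_eq_lintegral_ofReal
      (by simpa using (hW.memLp_sub _ _ q).integrable_norm_pow (by omega)) (ae_of_all _ fun _ ↦ by positivity),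
      hW.integral_abs_sub_pow, mul_comm]
    apply ENNReal.ofReal_le_ofReal
    gcongr
    have : |(((j + 1 : ℕ) / 2 ^ n : ℝ≥0) : ℝ) - ((j / 2 ^ n : ℝ≥0) : ℝ)| = (1 / 2) ^ n := by
      push_cast
      rw [← sub_div, add_sub_cancel_left, abs_of_nonneg (by positivity), one_div_pow]
    rw [this]
    have h1 : √((1 / 2 : ℝ) ^ n) ≤ 1 := by
      rw [Real.sqrt_le_one]; exact pow_le_one₀ (by norm_num) (by norm_num)
    calc √((1 / 2 : ℝ) ^ n) ^ q ≤ √((1 / 2 : ℝ) ^ n) ^ 6 :=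
          pow_le_pow_of_le_one (Real.sqrt_nonneg _) h1 hq
      _ = (√((1 / 2 : ℝ) ^ n) ^ 2) ^ 3 := by ring
      _ = (1 / 8) ^ n := by
          rw [Real.sq_sqrt (by positivity), ← pow_mul, mul_comm, pow_mul]; norm_num
  -- The weight `2 ^ n` yields the decay: each term is at most `Q`, so `|D n j| ≤ Q^(1/q) *
  -- (2^(-1/q))^n`, whence `R` and `r` below.
  set Q : Ω → ENNReal := fun ω ↦ ∑' n : ℕ, ∑ j ∈ Finset.range (2 ^ n * T + 1),
    2 ^ n * ‖D n j ω‖ₑ ^ q with hQ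
  have mQ : AEMeasurable Q P := by
    refine AEMeasurable.tsum fun n ↦ Finset.aemeasurable_fun_sum _ fun j _ ↦ ?_
    exact ((mD n j).enorm.pow_const q).const_mul _
  have EQ : ∫⁻ ω, Q ω ∂P ≠ ⊤ := by
    rw [lintegral_tsum fun n ↦ Finset.aemeasurable_fun_sum _ fun j _ ↦
      ((mD n j).enorm.pow_const q).const_mul _]
    have b n : ∫⁻ ω, ∑ j ∈ Finset.range (2 ^ n * T + 1), 2 ^ n * ‖D n j ω‖ₑ ^ q ∂P ≤
        ENNReal.ofReal ((T + 1) * c * (1 / 2) ^ n) := by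
      rw [lintegral_finsetSum' _ fun j _ ↦ ((mD n j).enorm.pow_const q).const_mul _]
      have b' j : ∫⁻ ω, 2 ^ n * ‖D n j ω‖ₑ ^ q ∂P ≤ ENNReal.ofReal (2 ^ n * (c * (1 / 8) ^ n)) := by
        rw [lintegral_const_mul' _ _ (by finiteness), ENNReal.ofReal_mul (by positivity)]
        gcongr
        · rw [ENNReal.ofReal_pow (by norm_num)]; simp
        · exact ED n j
      refine (Finset.sum_le_sum fun j _ ↦ b' j).trans ?_
      rw [Finset.sum_const, Finset.card_range, nsmul_eq_mul, ← ENNReal.ofReal_natCast,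
        ← ENNReal.ofReal_mul (by positivity)]
      apply ENNReal.ofReal_le_ofReal
      have : ((2 ^ n * T + 1 : ℕ) : ℝ) ≤ 2 ^ n * (T + 1) := by
        push_cast
        have : (1 : ℝ) ≤ 2 ^ n := one_le_pow₀ (by norm_num)
        linarith
      calc ((2 ^ n * T + 1 : ℕ) : ℝ) * (2 ^ n * (c * (1 / 8) ^ n))
          ≤ (2 ^ n * (T + 1)) * (2 ^ n * (c * (1 / 8) ^ n)) := by gcongr
        _ = (T + 1) * c * (2 * 2 * (1 / 8)) ^ n := by rw [mul_pow, mul_pow]; ring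
        _ = _ := by norm_num
    refine ne_top_of_le_ne_top ?_ (ENNReal.tsum_le_tsum b)
    exact ((summable_geometric_of_lt_one (by norm_num) (by norm_num)).mul_left _).tsum_ofReal_ne_top
  have fQ := ae_lt_top' mQ EQ
  set R : Ω → ℝ := fun ω ↦ (Q ω).toReal ^ (1 / q : ℝ) with hR
  have R0 ω : 0 ≤ R ω := by positivity
  have Rq ω : R ω ^ q = (Q ω).toReal := by
    rw [hR, ← Real.rpow_natCast, ← Real.rpow_mul ENNReal.toReal_nonneg, one_div_mul_cancel q0,
      Real.rpow_one]
  set r : ℝ := (1 / 2 : ℝ) ^ (1 / q : ℝ) with hr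
  have r0 : 0 ≤ r := by positivity
  have rq : r ^ q = 1 / 2 := by
    rw [hr, ← Real.rpow_natCast, ← Real.rpow_mul (by norm_num), one_div_mul_cancel q0,
      Real.rpow_one]
  refine ⟨R, ?_, R0, r, r0, Real.rpow_lt_one (by norm_num) (by norm_num) (by positivity), ?_⟩
  · have mR : AEStronglyMeasurable R P :=
      (mQ.ennreal_toReal.pow_const _).aestronglyMeasurable
    rw [← integrable_norm_rpow_iff mR (by simp; omega) (by simp)]
    simp only [ENNReal.toReal_natCast, Real.rpow_natCast]
    have : (fun ω ↦ ‖R ω‖ ^ q) = fun ω ↦ (Q ω).toReal := by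
      ext ω; rw [Real.norm_of_nonneg (R0 ω), Rq]
    rw [this]
    exact integrable_toReal_of_lintegral_ne_top mQ EQ
  · filter_upwards [fQ] with ω hω n j hj
    have h1 : 2 ^ n * ‖D n j ω‖ₑ ^ q ≤ Q ω := by
      refine le_trans ?_ (ENNReal.le_tsum n)
      exact Finset.single_le_sum (f := fun j ↦ 2 ^ n * ‖D n j ω‖ₑ ^ q) (fun _ _ ↦ zero_le)
        (by simpa using Nat.lt_succ_of_le hj)
    have h2 := ENNReal.toReal_mono hω.ne h1
    simp only [ENNReal.toReal_mul, ENNReal.toReal_pow, ENNReal.toReal_ofNat, toReal_enorm,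
      Real.norm_eq_abs] at h2
    have h3 : |D n j ω| ^ q ≤ (R ω * r ^ n) ^ q := by
      rw [mul_pow, Rq, ← pow_mul, mul_comm n, pow_mul, rq, one_div_pow, mul_one_div,
        le_div_iff₀ (by positivity)]
      linarith
    exact (pow_le_pow_iff_left₀ (abs_nonneg _) (mul_nonneg (R0 ω) (by positivity)) (by omega)).1 h3

theorem ProbabilityTheory.IsBrownianReal.exists_memLp_forall_abs_le {Ω : Type*}
    {mΩ : MeasurableSpace Ω} {P : Measure Ω} {W : ℝ≥0 → Ω → ℝ} (hW : IsBrownianReal W P)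
    (T : ℝ≥0) (p : ℕ) :
    ∃ K : Ω → ℝ, MemLp K p P ∧ ∀ᵐ ω ∂P, ∀ u ≤ T, |W u ω| ≤ K ω := by
  have hP := hW.isGaussianProcess.isProbabilityMeasure
  obtain ⟨N, hN⟩ := exists_nat_ge T
  obtain ⟨R, mR, R0, r, r0, r1, hRr⟩ :=
    hW.toIsPreBrownianReal.exists_dyadic_increments_le N (p + 6) (by omega)
  refine ⟨fun ω ↦ ∑ k ∈ Finset.range (N + 1), |W k ω| + R ω / (1 - r), ?_, ?_⟩
  · have h1 : MemLp R p P := mR.mono_exponent (by exact_mod_cast Nat.le_add_right p 6)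
    have h2 : MemLp (fun ω ↦ R ω / (1 - r)) p P := by
      simpa [div_eq_inv_mul] using h1.const_mul (1 - r)⁻¹
    exact (memLp_finsetSum (Finset.range (N + 1))
      fun k _ ↦ (hW.toIsPreBrownianReal.memLp k p).abs).add h2
  · filter_upwards [hW.cont, hRr] with ω hc h u hu
    exact abs_le_of_dyadic_increments_le hc N r0 r1 (R0 ω) h (hu.trans hN)

/-! ### Adaptedness as measurable dependence on the available information. -/

section AEFactorsThrough

variable {Ω E : Type*} {mΩ : MeasurableSpace Ω} [MeasurableSpace E]

/-- `X` is almost surely equal to a measurable function of `ξ`. -/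
def AEFactorsThrough (ξ : Ω → E) (X : Ω → ℝ) (P : Measure Ω) : Prop :=
  ∃ Φ : E → ℝ, Measurable Φ ∧ X =ᵐ[P] Φ ∘ ξ

variable {P : Measure Ω} {ξ : Ω → E} {X Y : Ω → ℝ}

theorem AEFactorsThrough.aemeasurable (hX : AEFactorsThrough (id : Ω → Ω) X P) :
    AEMeasurable X P :=
  let ⟨Φ, hΦ, h⟩ := hX
  ⟨Φ, hΦ, h⟩

theorem AEMeasurable.aeFactorsThrough_id (hX : AEMeasurable X P) :
    AEFactorsThrough (id : Ω → Ω) X P :=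
  ⟨hX.mk X, hX.measurable_mk, hX.ae_eq_mk⟩

namespace AEFactorsThrough

theorem congr (hX : AEFactorsThrough ξ X P) (h : Y =ᵐ[P] X) : AEFactorsThrough ξ Y P :=
  let ⟨Φ, hΦ, hX⟩ := hX
  ⟨Φ, hΦ, h.trans hX⟩

theorem const (c : ℝ) : AEFactorsThrough ξ (fun _ ↦ c) P :=
  ⟨fun _ ↦ c, measurable_const, .rfl⟩

theorem add (hX : AEFactorsThrough ξ X P) (hY : AEFactorsThrough ξ Y P) :
    AEFactorsThrough ξ (fun ω ↦ X ω + Y ω) P := by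
  obtain ⟨Φ, hΦ, hX⟩ := hX
  obtain ⟨Ψ, hΨ, hY⟩ := hY
  refine ⟨fun e ↦ Φ e + Ψ e, hΦ.add hΨ, ?_⟩
  filter_upwards [hX, hY] with ω h1 h2
  simp [h1, h2]

theorem mul (hX : AEFactorsThrough ξ X P) (hY : AEFactorsThrough ξ Y P) :
    AEFactorsThrough ξ (fun ω ↦ X ω * Y ω) P := by
  obtain ⟨Φ, hΦ, hX⟩ := hX
  obtain ⟨Ψ, hΨ, hY⟩ := hY
  refine ⟨fun e ↦ Φ e * Ψ e, hΦ.mul hΨ, ?_⟩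
  filter_upwards [hX, hY] with ω h1 h2
  simp [h1, h2]

theorem integral {X : ℝ≥0 → Ω → ℝ} {t : ℝ≥0} (hX : ∀ s ≤ t, AEFactorsThrough ξ (X s) P)
    (hc : ∀ᵐ ω ∂P, Continuous (X · ω)) :
    AEFactorsThrough ξ (fun ω ↦ ∫ u in (0 : ℝ)..t, X u.toNNReal ω) P := by
  choose Φ mΦ hΦ using fun s ↦ hX (min s t) (min_le_right _ _)
  -- The functions `Φ s` are chosen separately for each `s`, with no joint measurability. Sampling
  -- at dyadic times uses countably many of them, which is jointly measurable, and path continuity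
  -- recovers the integrand in the limit.
  let L : ℝ × E → ℝ := fun p ↦ limUnder atTop fun n ↦ Φ (dyadicFloor n p.1.toNNReal) p.2
  have mL : StronglyMeasurable L := by
    refine StronglyMeasurable.limUnder fun n ↦ Measurable.stronglyMeasurable ?_
    have h1 : Measurable fun q : ℕ × E ↦ Φ ((q.1 : ℝ≥0) / 2 ^ n) q.2 :=
      measurable_from_prod_countable_right fun k ↦ mΦ (k / 2 ^ n)
    have h2 : Measurable fun p : ℝ × E ↦ ((⌊2 ^ n * p.1.toNNReal⌋₊, p.2) : ℕ × E) := by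
      refine Measurable.prodMk (Nat.measurable_floor.comp ?_) measurable_snd
      fun_prop
    exact h1.comp h2
  refine ⟨fun e ↦ ∫ u in (0 : ℝ)..t, L (u, e), ?_, ?_⟩
  · simp_rw [intervalIntegral.integral_of_le t.coe_nonneg]
    exact mL.integral_prod_left.measurable
  · have hae : ∀ᵐ ω ∂P, ∀ n k : ℕ,
        X (min ((k : ℝ≥0) / 2 ^ n) t) ω = Φ ((k : ℝ≥0) / 2 ^ n) (ξ ω) :=
      ae_all_iff.2 fun n ↦ ae_all_iff.2 fun k ↦ hΦ _
    filter_upwards [hae, hc] with ω h hω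
    refine intervalIntegral.integral_congr fun u hu ↦ ?_
    rw [Set.uIcc_of_le t.coe_nonneg] at hu
    have hut : u.toNNReal ≤ t := Real.toNNReal_le_iff_le_coe.2 hu.2
    have lim : Tendsto (fun n ↦ X (min (dyadicFloor n u.toNNReal) t) ω) atTop
        (𝓝 (X u.toNNReal ω)) := by
      have := (hω.tendsto (min u.toNNReal t)).comp
        ((tendsto_dyadicFloor u.toNNReal).min tendsto_const_nhds)
      rwa [min_eq_left hut] at this
    refine (Tendsto.limUnder_eq (lim.congr fun n ↦ ?_)).symm
    exact h n _

end AEFactorsThrough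

end AEFactorsThrough

/-! ### Regular processes and their closure properties. -/

section RegularProcess

variable {Ω E : Type*} {mΩ : MeasurableSpace Ω} [MeasurableSpace E]

/-- A process with almost surely continuous paths that is adapted to the information `ξ`, and whose
suprema over bounded intervals of time have finite moments of all orders. -/
structure RegularProcess (ξ : ℝ≥0 → Ω → E) (X : ℝ≥0 → Ω → ℝ) (P : Measure Ω) : Prop where
  adapted : ∀ s t, s ≤ t → AEFactorsThrough (ξ t) (X s) P
  cont : ∀ᵐ ω ∂P, Continuous (X · ω)
  moments : ∀ (T : ℝ≥0) (p : ℕ), ∃ K : Ω → ℝ, MemLp K p P ∧ ∀ᵐ ω ∂P, ∀ u ≤ T, |X u ω| ≤ K ω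

theorem MeasureTheory.MemLp.mul_of_two_mul {P : Measure Ω} {f g : Ω → ℝ} {p : ℕ}
    (hf : MemLp f (2 * p : ℕ) P) (hg : MemLp g (2 * p : ℕ) P) :
    MemLp (fun ω ↦ f ω * g ω) p P := by
  have : ENNReal.HolderTriple (2 * p : ℕ) (2 * p : ℕ) p := by
    constructor
    push_cast
    rw [ENNReal.mul_inv (by simp) (by simp), ← add_mul, ENNReal.inv_two_add_inv_two, one_mul]
  exact hg.mul hf

variable {P : Measure Ω} {ξ : ℝ≥0 → Ω → E} {X Y : ℝ≥0 → Ω → ℝ}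

namespace RegularProcess

theorem congr (hX : RegularProcess ξ X P) (h : ∀ᵐ ω ∂P, ∀ t, Y t ω = X t ω) :
    RegularProcess ξ Y P where
  adapted s t hst := (hX.adapted s t hst).congr (h.mono fun _ h ↦ h s)
  cont := by
    filter_upwards [hX.cont, h] with ω h1 h2
    exact (funext h2 : (Y · ω) = (X · ω)) ▸ h1
  moments T p := by
    obtain ⟨K, mK, hK⟩ := hX.moments T p
    refine ⟨K, mK, ?_⟩
    filter_upwards [hK, h] with ω h1 h2 u hu
    rw [h2]; exact h1 u hu

theorem add (hX : RegularProcess ξ X P) (hY : RegularProcess ξ Y P) :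
    RegularProcess ξ (fun t ω ↦ X t ω + Y t ω) P where
  adapted s t hst := (hX.adapted s t hst).add (hY.adapted s t hst)
  cont := by filter_upwards [hX.cont, hY.cont] with ω h1 h2 using h1.add h2
  moments T p := by
    obtain ⟨K, mK, hK⟩ := hX.moments T p
    obtain ⟨L, mL, hL⟩ := hY.moments T p
    refine ⟨fun ω ↦ K ω + L ω, mK.add mL, ?_⟩
    filter_upwards [hK, hL] with ω h1 h2 u hu
    exact (abs_add_le _ _).trans (add_le_add (h1 u hu) (h2 u hu))

theorem mul (hX : RegularProcess ξ X P) (hY : RegularProcess ξ Y P) :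
    RegularProcess ξ (fun t ω ↦ X t ω * Y t ω) P where
  adapted s t hst := (hX.adapted s t hst).mul (hY.adapted s t hst)
  cont := by filter_upwards [hX.cont, hY.cont] with ω h1 h2 using h1.mul h2
  moments T p := by
    obtain ⟨K, mK, hK⟩ := hX.moments T (2 * p)
    obtain ⟨L, mL, hL⟩ := hY.moments T (2 * p)
    refine ⟨fun ω ↦ K ω * L ω, mK.mul_of_two_mul mL, ?_⟩
    filter_upwards [hK, hL] with ω h1 h2 u hu
    rw [abs_mul]
    exact mul_le_mul (h1 u hu) (h2 u hu) (abs_nonneg _) ((abs_nonneg _).trans (h1 u hu))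

theorem of_continuous [IsFiniteMeasure P] {f : ℝ≥0 → ℝ} (hf : Continuous f) :
    RegularProcess ξ (fun t _ ↦ f t) P where
  adapted s _ _ := .const (f s)
  cont := ae_of_all _ fun _ ↦ hf
  moments T p := by
    obtain ⟨C, hC⟩ := (isCompact_Icc (a := (0 : ℝ≥0)) (b := T)).exists_bound_of_continuousOn
      hf.continuousOn
    exact ⟨fun _ ↦ C, memLp_const C, ae_of_all _ fun _ u hu ↦ hC u ⟨zero_le, hu⟩⟩

theorem const [IsFiniteMeasure P] (c : ℝ) : RegularProcess ξ (fun _ _ ↦ c) P :=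
  of_continuous continuous_const

theorem const_mul [IsFiniteMeasure P] (c : ℝ) (hX : RegularProcess ξ X P) :
    RegularProcess ξ (fun t ω ↦ c * X t ω) P :=
  (const c).mul hX

theorem sub [IsFiniteMeasure P] (hX : RegularProcess ξ X P) (hY : RegularProcess ξ Y P) :
    RegularProcess ξ (fun t ω ↦ X t ω - Y t ω) P :=
  (hX.add (hY.const_mul (-1))).congr (ae_of_all _ fun ω t ↦ by ring)

theorem pow [IsFiniteMeasure P] (hX : RegularProcess ξ X P) (n : ℕ) :
    RegularProcess ξ (fun t ω ↦ X t ω ^ n) P := by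
  induction n with
  | zero => simpa using const 1
  | succ n ih => simpa only [pow_succ] using ih.mul hX

theorem integral [IsFiniteMeasure P] (hX : RegularProcess ξ X P) :
    RegularProcess ξ (fun t ω ↦ ∫ u in (0 : ℝ)..t, X u.toNNReal ω) P where
  adapted s t hst := .integral (fun r hr ↦ hX.adapted r t (hr.trans hst)) hX.cont
  cont := by
    filter_upwards [hX.cont] with ω h
    have h' : Continuous fun u : ℝ ↦ X u.toNNReal ω := h.comp continuous_real_toNNReal
    exact (intervalIntegral.continuous_primitive (fun a b ↦ h'.intervalIntegrable a b) 0).comp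
      NNReal.continuous_coe
  moments T p := by
    obtain ⟨K, mK, hK⟩ := hX.moments T p
    refine ⟨fun ω ↦ T * K ω, mK.const_mul (T : ℝ), ?_⟩
    filter_upwards [hK] with ω h u hu
    have K0 : 0 ≤ K ω := (abs_nonneg _).trans (h 0 zero_le)
    have := intervalIntegral.norm_integral_le_of_norm_le_const (a := 0) (b := (u : ℝ))
      (f := fun r ↦ X r.toNNReal ω) (C := K ω) fun r hr ↦ by
        rw [Set.uIoc_of_le u.coe_nonneg] at hr
        exact h _ ((Real.toNNReal_le_iff_le_coe.2 hr.2).trans hu)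
    rw [sub_zero, abs_of_nonneg u.coe_nonneg, mul_comm] at this
    exact this.trans (by gcongr)

theorem memLp [IsFiniteMeasure P] (hX : RegularProcess (fun _ ↦ (id : Ω → Ω)) X P) (t : ℝ≥0)
    (p : ℕ) : MemLp (X t) p P := by
  obtain ⟨K, mK, hK⟩ := hX.moments t p
  exact mK.mono' (hX.adapted t t le_rfl).aemeasurable.aestronglyMeasurable
    (hK.mono fun ω h ↦ h t le_rfl)

theorem integrable [IsFiniteMeasure P] (hX : RegularProcess (fun _ ↦ (id : Ω → Ω)) X P)
    (t : ℝ≥0) : Integrable (X t) P := by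
  simpa [memLp_one_iff_integrable] using hX.memLp t 1

theorem continuous_integral [IsFiniteMeasure P]
    (hX : RegularProcess (fun _ ↦ (id : Ω → Ω)) X P) : Continuous fun t ↦ ∫ ω, X t ω ∂P := by
  refine continuous_iff_continuousAt.2 fun t ↦ ?_
  obtain ⟨K, mK, hK⟩ := hX.moments (t + 1) 1
  refine continuousAt_of_dominated (bound := K)
    (.of_forall fun s ↦ (hX.adapted s s le_rfl).aemeasurable.aestronglyMeasurable) ?_
    (by simpa [memLp_one_iff_integrable] using mK)
    (hX.cont.mono fun ω h ↦ h.continuousAt)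
  filter_upwards [Iic_mem_nhds (show t < t + 1 by simp)] with s hs
  exact hK.mono fun ω h ↦ h s hs

end RegularProcess

/-- The path `n` need not be differentiable, but `y = x - n` is, with `y' = a - κ n - κ y`; the
integrating factor `exp (κ r)` solves this. -/
theorem eq_exp_mul_of_linear_drift {κ x₀ : ℝ} {a n x : ℝ≥0 → ℝ} (ha : Continuous a)
    (hn : Continuous n) (hx : Continuous x)
    (h : ∀ t : ℝ≥0, x t = x₀ + (∫ u in (0 : ℝ)..t, (a u.toNNReal - κ * x u.toNNReal)) + n t)
    (t : ℝ≥0) :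
    x t = Real.exp (-κ * t) * (x₀ + ∫ u in (0 : ℝ)..t,
      Real.exp (κ * u.toNNReal) * (a u.toNNReal - κ * n u.toNNReal)) + n t := by
  have ha' : Continuous fun u : ℝ ↦ a u.toNNReal := ha.comp continuous_real_toNNReal
  have hn' : Continuous fun u : ℝ ↦ n u.toNNReal := hn.comp continuous_real_toNNReal
  have hx' : Continuous fun u : ℝ ↦ x u.toNNReal := hx.comp continuous_real_toNNReal
  set y : ℝ → ℝ := fun r ↦ x₀ + ∫ u in (0 : ℝ)..r, (a u.toNNReal - κ * x u.toNNReal) with hy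
  have dy r : HasDerivAt y (a r.toNNReal - κ * x r.toNNReal) r :=
    (intervalIntegral.integral_hasDerivAt_right
      ((ha'.sub (hx'.const_mul κ)).intervalIntegrable _ _)
      ((ha'.sub (hx'.const_mul κ)).stronglyMeasurableAtFilter _ _)
      (ha'.sub (hx'.const_mul κ)).continuousAt).const_add x₀
  have dz r : HasDerivAt (fun r ↦ Real.exp (κ * r) * y r)
      (Real.exp (κ * r) * (κ * y r + (a r.toNNReal - κ * x r.toNNReal))) r := by
    have := (((hasDerivAt_id r).const_mul κ).exp).mul (dy r)
    refine this.congr_deriv ?_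
    simp; ring
  have hy0 : y 0 = x₀ := by simp [hy]
  have key := intervalIntegral.integral_eq_sub_of_hasDerivAt (a := 0) (b := t) (fun r _ ↦ dz r) (by
    refine Continuous.intervalIntegrable ?_ _ _
    have : Continuous y := continuous_iff_continuousAt.2 fun r ↦ (dy r).continuousAt
    fun_prop)
  have congr : ∫ u in (0 : ℝ)..t, Real.exp (κ * u.toNNReal) * (a u.toNNReal - κ * n u.toNNReal)
      = ∫ r in (0 : ℝ)..t, Real.exp (κ * r) * (κ * y r + (a r.toNNReal - κ * x r.toNNReal)) := by
    refine intervalIntegral.integral_congr fun r hr ↦ ?_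
    rw [Set.uIcc_of_le t.coe_nonneg] at hr
    have : x r.toNNReal = y r + n r.toNNReal := by
      rw [h, hy, Real.coe_toNNReal _ hr.1]
    simp only [this, Real.coe_toNNReal _ hr.1]
    ring
  rw [congr, key, hy0]
  have e : Real.exp (-κ * t) * Real.exp (κ * t) = 1 := by rw [← Real.exp_add]; simp
  rw [h t]
  change y t + n t = _
  simp only [mul_zero, Real.exp_zero, one_mul]
  linear_combination -y t * e

/-- The explicit solution is built from the forcing and the noise by operations that preserve
regularity, so no a priori estimate on `X` is required. -/
theorem IsAdditiveNoiseSolution.regularProcess [IsFiniteMeasure P] {x₀ κ σ : ℝ}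
    {a W : ℝ≥0 → Ω → ℝ}
    (hX : IsAdditiveNoiseSolution x₀ (fun t ω ↦ a t ω - κ * X t ω) σ W X P)
    (ha : RegularProcess ξ a P) (hW : RegularProcess ξ W P) : RegularProcess ξ X P := by
  have e1 : RegularProcess ξ (fun t _ ↦ Real.exp (-κ * t)) P := .of_continuous (by fun_prop)
  have e2 : RegularProcess ξ (fun t _ ↦ Real.exp (κ * t)) P := .of_continuous (by fun_prop)
  have hN := hW.const_mul σ
  refine RegularProcess.congr
    ((e1.mul ((RegularProcess.const x₀).add
      (e2.mul (ha.sub (hN.const_mul κ))).integral)).add hN) ?_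
  filter_upwards [hX.cont, hX.eqn, ha.cont, hN.cont] with ω h1 h2 h3 h4
  exact eq_exp_mul_of_linear_drift h3 h4 h1 h2

end RegularProcess

theorem exists_dominating {Ω E : Type*} {mΩ : MeasurableSpace Ω} [MeasurableSpace E]
    {P : Measure Ω} [IsFiniteMeasure P] {ξ : ℝ≥0 → Ω → E} {X : Fin 5 → ℝ≥0 → Ω → ℝ}
    (hX : ∀ i, RegularProcess ξ (X i) P) (T : ℝ≥0) (p : ℕ) :
    ∃ K : Ω → ℝ, MemLp K p P ∧ ∀ᵐ ω ∂P, ∀ i, ∀ u ≤ T, |X i u ω| ≤ K ω := by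
  choose K mK hK using fun i ↦ (hX i).moments T p
  refine ⟨fun ω ↦ ∑ i, K i ω, memLp_finsetSum _ fun i _ ↦ mK i, ?_⟩
  filter_upwards [ae_all_iff.2 hK] with ω h i u hu
  refine (h i u hu).trans (Finset.single_le_sum (f := fun i ↦ K i ω) (fun j _ ↦ ?_)
    (Finset.mem_univ i))
  exact (abs_nonneg _).trans (h j 0 zero_le)

/-! ### Pathwise estimates for the drift part of an increment. -/

section Drift

variable {x₀ σ : ℝ} {b w x : ℝ≥0 → ℝ}

theorem sub_sub_mul_sub_eq_integral (hb : Continuous b)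
    (h : ∀ t : ℝ≥0, x t = x₀ + (∫ u in (0 : ℝ)..t, b u.toNNReal) + σ * w t) (s t : ℝ≥0) :
    x s - x t - σ * (w s - w t) = ∫ u in (t : ℝ)..s, b u.toNNReal := by
  have hb' : Continuous fun u : ℝ ↦ b u.toNNReal := hb.comp continuous_real_toNNReal
  rw [← intervalIntegral.integral_interval_sub_left (hb'.intervalIntegrable 0 s)
    (hb'.intervalIntegrable 0 t), h s, h t]
  ring

theorem abs_drift_increment_le (hb : Continuous b)
    (h : ∀ t : ℝ≥0, x t = x₀ + (∫ u in (0 : ℝ)..t, b u.toNNReal) + σ * w t) {s t : ℝ≥0}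
    (hts : t ≤ s) {K : ℝ} (hK : ∀ u ≤ s, |b u| ≤ K) :
    |x s - x t - σ * (w s - w t)| ≤ K * (s - t) := by
  have hts' : (t : ℝ) ≤ s := hts
  rw [sub_sub_mul_sub_eq_integral hb h, ← abs_of_nonneg (sub_nonneg.2 hts')]
  refine intervalIntegral.norm_integral_le_of_norm_le_const
    (f := fun u : ℝ ↦ b u.toNNReal) fun u hu ↦ hK _ ?_
  rw [Set.uIoc_of_le hts'] at hu
  exact Real.toNNReal_le_iff_le_coe.2 hu.2

theorem tendsto_drift_increment_div (hb : Continuous b)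
    (h : ∀ t : ℝ≥0, x t = x₀ + (∫ u in (0 : ℝ)..t, b u.toNNReal) + σ * w t) (t : ℝ≥0) :
    Tendsto (fun s : ℝ≥0 ↦ (x s - x t - σ * (w s - w t)) / (s - t)) (𝓝[>] t) (𝓝 (b t)) := by
  have hb' : Continuous fun u : ℝ ↦ b u.toNNReal := hb.comp continuous_real_toNNReal
  have hd : HasDerivAt (fun r : ℝ ↦ ∫ u in (t : ℝ)..r, b u.toNNReal) (b t) t := by
    simpa using intervalIntegral.integral_hasDerivAt_right (hb'.intervalIntegrable (t : ℝ) t)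
      (hb'.stronglyMeasurableAtFilter _ _) hb'.continuousAt
  have hc : Tendsto (fun s : ℝ≥0 ↦ (s : ℝ)) (𝓝[>] t) (𝓝[≠] (t : ℝ)) := by
    refine tendsto_nhdsWithin_iff.2 ⟨NNReal.continuous_coe.continuousAt.mono_left
      nhdsWithin_le_nhds, ?_⟩
    filter_upwards [self_mem_nhdsWithin] with s (hs : t < s)
    simpa using hs.ne'
  refine (hd.tendsto_slope.comp hc).congr fun s ↦ ?_
  simp [slope_def_field, sub_sub_mul_sub_eq_integral hb h]

end Drift

/-! ### Expectations involving noise increments. -/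

section Increments

variable {Ω : Type*} {mΩ : MeasurableSpace Ω} {P : Measure Ω} {ρ : ℝ} {B W : ℝ≥0 → Ω → ℝ}

namespace IsCorrelatedBrownianPair

theorem integral_mul_increment (hBW : IsCorrelatedBrownianPair ρ B W P) {t : ℝ≥0} (h : ℝ≥0)
    {Y : Ω → ℝ} (hY : AEFactorsThrough (pastPair B W t) Y P) (mY : AEMeasurable Y P) {g : ℝ → ℝ → ℝ}
    (hg : Continuous g.uncurry) :
    ∫ ω, Y ω * g (B (t + h) ω - B t ω) (W (t + h) ω - W t ω) ∂P =
      (∫ ω, Y ω ∂P) * ∫ ω, g (B (t + h) ω - B t ω) (W (t + h) ω - W t ω) ∂P := by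
  obtain ⟨Φ, mΦ, hΦ⟩ := hY
  have mg : Measurable fun x : Bool → ℝ ↦ g (x true) (x false) :=
    hg.measurable.comp (f := fun x : Bool → ℝ ↦ (x true, x false)) (by fun_prop)
  have ind := ((hBW.indepFun_increment_past t h).comp mg mΦ).symm
  have ind' : IndepFun Y (fun ω ↦ g (B (t + h) ω - B t ω) (W (t + h) ω - W t ω)) P :=
    ind.congr hΦ.symm .rfl
  refine ind'.integral_fun_mul_eq_mul_integral mY.aestronglyMeasurable ?_
  have aB t : AEMeasurable (B t) P := hBW.fst.toIsPreBrownianReal.aemeasurable t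
  have aW t : AEMeasurable (W t) P := hBW.snd.toIsPreBrownianReal.aemeasurable t
  exact (hg.measurable.comp_aemeasurable
    (((aB _).sub (aB _)).prodMk ((aW _).sub (aW _)))).aestronglyMeasurable

theorem integral_increment_sq (hBW : IsCorrelatedBrownianPair ρ B W P) (t h : ℝ≥0) :
    ∫ ω, (B (t + h) ω - B t ω) ^ 2 ∂P = h := by
  have hB := hBW.fst.toIsPreBrownianReal
  have h1 := hB.integral_abs_sub_pow (t + h) t 2
  have h2 : ∫ x, x ^ 2 ∂(gaussianReal 0 1) = 1 := by
    have := variance_eq_integral (μ := gaussianReal 0 1) (X := id) (by fun_prop)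
    simpa using this.symm
  simpa [h2] using h1

theorem integral_fst_increment (hBW : IsCorrelatedBrownianPair ρ B W P) (t h : ℝ≥0) :
    ∫ ω, (B (t + h) ω - B t ω) ∂P = 0 := by
  have hB := hBW.fst.toIsPreBrownianReal
  rw [integral_sub (hB.integrable_eval _) (hB.integrable_eval _)]
  simp [hB.integral_eval]

theorem integral_snd_increment (hBW : IsCorrelatedBrownianPair ρ B W P) (t h : ℝ≥0) :
    ∫ ω, (W (t + h) ω - W t ω) ∂P = 0 := by
  have hW := hBW.snd.toIsPreBrownianReal
  rw [integral_sub (hW.integrable_eval _) (hW.integrable_eval _)]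
  simp [hW.integral_eval]

/-- With `δ = √h`, the inequality `y² z ≤ y⁴ / (2δ) + δ z² / 2` balances the two moments: both terms
have expectation of order `δ³`, which is `o(h)`. -/
theorem exists_abs_integral_increment_sq_mul_le (hBW : IsCorrelatedBrownianPair ρ B W P) :
    ∃ C : ℝ, ∀ t h : ℝ≥0, 0 < h →
      |∫ ω, (B (t + h) ω - B t ω) ^ 2 * (W (t + h) ω - W t ω) ∂P| ≤ C * √h * h := by
  have hB := hBW.fst.toIsPreBrownianReal
  have hW := hBW.snd.toIsPreBrownianReal
  refine ⟨((∫ x, |x| ^ 4 ∂(gaussianReal 0 1)) + ∫ x, |x| ^ 2 ∂(gaussianReal 0 1)) / 2,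
    fun t h hh ↦ ?_⟩
  have hB4 := hB.integral_abs_sub_pow (t + h) t 4
  have hW2 := hW.integral_abs_sub_pow (t + h) t 2
  have iB4 : Integrable (fun ω ↦ |B (t + h) ω - B t ω| ^ 4) P := by
    simpa using (hB.memLp_sub (t + h) t 4).integrable_norm_pow (by norm_num)
  have iW2 : Integrable (fun ω ↦ |W (t + h) ω - W t ω| ^ 2) P := by
    simpa using (hW.memLp_sub (t + h) t 2).integrable_norm_pow (by norm_num)
  have e : |((t + h : ℝ≥0) : ℝ) - t| = h := by simp
  rw [e] at hB4 hW2
  set δ := √(h : ℝ) with hδ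
  have δ0 : 0 < δ := Real.sqrt_pos.2 hh
  have δ2 : δ ^ 2 = h := Real.sq_sqrt h.coe_nonneg
  calc |∫ ω, (B (t + h) ω - B t ω) ^ 2 * (W (t + h) ω - W t ω) ∂P|
      ≤ ∫ ω, (|B (t + h) ω - B t ω| ^ 4 / (2 * δ) + δ / 2 * |W (t + h) ω - W t ω| ^ 2) ∂P := by
        rw [← Real.norm_eq_abs]
        refine norm_integral_le_of_norm_le ((iB4.div_const _).add (iW2.const_mul _))
          (ae_of_all _ fun ω ↦ ?_)
        simp only [Real.norm_eq_abs, abs_mul, abs_pow]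
        set y := |B (t + h) ω - B t ω|
        set z := |W (t + h) ω - W t ω|
        have : y ^ 4 / (2 * δ) + δ / 2 * z ^ 2 - y ^ 2 * z = (y ^ 2 - δ * z) ^ 2 / (2 * δ) := by
          field_simp; ring
        have : 0 ≤ (y ^ 2 - δ * z) ^ 2 / (2 * δ) := by positivity
        linarith
    _ = _ := by
        rw [integral_add (iB4.div_const _) (iW2.const_mul _), integral_div, integral_const_mul,
          hB4, hW2, ← δ2]
        field_simp

end IsCorrelatedBrownianPair

end Increments

/-! ### The right derivative of `E[X² Y]`. -/

section Moments

variable {Ω : Type*} {mΩ : MeasurableSpace Ω} {P : Measure Ω} {ρ σ τ x₀ y₀ : ℝ}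
  {B W X Y b c : ℝ≥0 → Ω → ℝ}

theorem integral_sq_mul_add_noise (hBW : IsCorrelatedBrownianPair ρ B W P) {t : ℝ≥0}
    (h : ℝ≥0) {x y : Ω → ℝ} (hx : AEFactorsThrough (pastPair B W t) x P)
    (hy : AEFactorsThrough (pastPair B W t) y P) (mx : ∀ p : ℕ, MemLp x p P)
    (my : ∀ p : ℕ, MemLp y p P) :
    ∫ ω, (x ω + σ * (B (t + h) ω - B t ω)) ^ 2 * (y ω + τ * (W (t + h) ω - W t ω)) ∂P =
      (∫ ω, x ω ^ 2 * y ω ∂P) + (σ ^ 2 * (∫ ω, y ω ∂P) + 2 * σ * τ * ρ * (∫ ω, x ω ∂P)) * h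
        + σ ^ 2 * τ * ∫ ω, (B (t + h) ω - B t ω) ^ 2 * (W (t + h) ω - W t ω) ∂P := by
  have := hBW.gaussian.isProbabilityMeasure
  have mul {f g : Ω → ℝ} (hf : ∀ p : ℕ, MemLp f p P) (hg : ∀ p : ℕ, MemLp g p P) (p : ℕ) :
      MemLp (fun ω ↦ f ω * g ω) p P := (hf _).mul_of_two_mul (hg _)
  have int {f : Ω → ℝ} (hf : ∀ p : ℕ, MemLp f p P) : Integrable f P := by
    simpa [memLp_one_iff_integrable] using hf 1
  have am {f : Ω → ℝ} (hf : ∀ p : ℕ, MemLp f p P) : AEMeasurable f P :=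
    (hf 0).aestronglyMeasurable.aemeasurable
  set d : Ω → ℝ := fun ω ↦ B (t + h) ω - B t ω with hd
  set e : Ω → ℝ := fun ω ↦ W (t + h) ω - W t ω with he
  have md (p : ℕ) : MemLp d p P := hBW.fst.toIsPreBrownianReal.memLp_sub _ _ p
  have me (p : ℕ) : MemLp e p P := hBW.snd.toIsPreBrownianReal.memLp_sub _ _ p
  have E1 := hBW.integral_mul_increment h (hx.mul hy) (am (mul mx my)) (g := fun u _ ↦ u)
    (by fun_prop)
  have E2 := hBW.integral_mul_increment h hy (am my) (g := fun u _ ↦ u ^ 2) (by fun_prop)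
  have E3 := hBW.integral_mul_increment h (hx.mul hx) (am (mul mx mx)) (g := fun _ v ↦ v)
    (by fun_prop)
  have E4 := hBW.integral_mul_increment h hx (am mx) (g := fun u v ↦ u * v) (by fun_prop)
  rw [hBW.integral_fst_increment, mul_zero] at E1
  rw [hBW.integral_increment_sq] at E2
  rw [hBW.integral_snd_increment, mul_zero] at E3
  rw [hBW.integral_increment_mul] at E4
  have I0 := int (mul (mul mx mx) my)
  have I1 := (int (mul (mul mx my) md)).const_mul (2 * σ)
  have I2 := (int (mul my (mul md md))).const_mul (σ ^ 2)
  have I3 := (int (mul (mul mx mx) me)).const_mul τ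
  have I4 := (int (mul mx (mul md me))).const_mul (2 * σ * τ)
  have I5 := (int (mul (mul md md) me)).const_mul (σ ^ 2 * τ)
  have expand : ∫ ω, (x ω + σ * d ω) ^ 2 * (y ω + τ * e ω) ∂P =
      ∫ ω, x ω * x ω * y ω + 2 * σ * (x ω * y ω * d ω) + σ ^ 2 * (y ω * (d ω * d ω))
        + τ * (x ω * x ω * e ω) + 2 * σ * τ * (x ω * (d ω * e ω))
        + σ ^ 2 * τ * (d ω * d ω * e ω) ∂P :=
    integral_congr_ae (ae_of_all _ fun ω ↦ by ring)
  change ∫ ω, (x ω + σ * d ω) ^ 2 * (y ω + τ * e ω) ∂P = _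
  rw [expand, integral_add ((((I0.fun_add I1).fun_add I2).fun_add I3).fun_add I4) I5,
    integral_add (((I0.fun_add I1).fun_add I2).fun_add I3) I4,
    integral_add ((I0.fun_add I1).fun_add I2) I3, integral_add (I0.fun_add I1) I2,
    integral_add I0 I1]
  simp only [integral_const_mul, ← pow_two (d _), ← pow_two (x _)]
  simp only [← pow_two (x _)] at E3
  rw [E1, E2, E3, E4]
  ring

theorem tendsto_integral_drift_part [IsFiniteMeasure P]
    (hX : IsAdditiveNoiseSolution x₀ b σ B X P) (hY : IsAdditiveNoiseSolution y₀ c τ W Y P)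
    (rX : RegularProcess (fun _ ↦ (id : Ω → Ω)) X P)
    (rY : RegularProcess (fun _ ↦ (id : Ω → Ω)) Y P)
    (rb : RegularProcess (fun _ ↦ (id : Ω → Ω)) b P)
    (rc : RegularProcess (fun _ ↦ (id : Ω → Ω)) c P)
    (rB : RegularProcess (fun _ ↦ (id : Ω → Ω)) B P)
    (rW : RegularProcess (fun _ ↦ (id : Ω → Ω)) W P) (t : ℝ≥0) :
    Tendsto (fun s : ℝ≥0 ↦ ∫ ω, (X s ω ^ 2 * Y s ω - (X t ω + σ * (B s ω - B t ω)) ^ 2 *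
        (Y t ω + τ * (W s ω - W t ω))) / (s - t) ∂P) (𝓝[>] t)
      (𝓝 (∫ ω, 2 * (X t ω * Y t ω * b t ω) + X t ω ^ 2 * c t ω ∂P)) := by
  -- The integrand is cubic in the processes, hence the third moment of `K`; the horizon `t + 1`
  -- covers all `s` close to `t`. `W` is not needed here, as it occurs only in an increment that
  -- cancels down to the drift of `Y`.
  obtain ⟨K, mK, hK⟩ := exists_dominating (X := ![X, Y, b, c, B]) (fun i ↦ by
    fin_cases i <;> assumption) (t + 1) 3
  have a {Z : ℝ≥0 → Ω → ℝ} (hZ : RegularProcess (fun _ ↦ (id : Ω → Ω)) Z P) (s : ℝ≥0) :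
      AEMeasurable (Z s) P := (hZ.adapted s s le_rfl).aemeasurable
  -- Telescoping: `p² Y - q² z = (p - q)(p + q) Y + q² (Y - z)`, so that `p - q` and `Y - z` are
  -- pure drift increments.
  have split (s : ℝ≥0) (ω : Ω) : (X s ω ^ 2 * Y s ω - (X t ω + σ * (B s ω - B t ω)) ^ 2 *
        (Y t ω + τ * (W s ω - W t ω))) / (s - t) =
      (X s ω - X t ω - σ * (B s ω - B t ω)) / (s - t) *
          (X s ω + (X t ω + σ * (B s ω - B t ω))) * Y s ω +
        (X t ω + σ * (B s ω - B t ω)) ^ 2 *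
          ((Y s ω - Y t ω - τ * (W s ω - W t ω)) / (s - t)) := by
    ring
  refine tendsto_integral_filter_of_dominated_convergence
    (fun ω ↦ ((2 + 2 * |σ|) + (1 + 2 * |σ|) ^ 2) * ‖K ω‖ ^ 3) ?_ ?_ ?_ ?_
  · refine .of_forall fun s ↦ AEMeasurable.aestronglyMeasurable ?_
    have h1 := a rX s
    have h2 := a rX t
    have h3 := a rY s
    have h4 := a rY t
    have h5 := a rB s
    have h6 := a rB t
    have h7 := a rW s
    have h8 := a rW t
    fun_prop
  · filter_upwards [self_mem_nhdsWithin,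
      nhdsWithin_le_nhds (Iic_mem_nhds (show t < t + 1 by simp))] with s (hts : t < s) hs
    have hs0 : (0 : ℝ) < s - t := sub_pos.2 hts
    filter_upwards [hK, hX.drift_cont, hY.drift_cont, hX.eqn, hY.eqn] with ω hK h1 h2 h3 h4
    have KX := hK 0
    have KY := hK 1
    have Kb := hK 2
    have Kc := hK 3
    have KB := hK 4
    simp only [Matrix.cons_val] at KX KY Kb Kc KB
    have K0 : 0 ≤ K ω := (abs_nonneg _).trans (KX 0 zero_le)
    have t1 : t ≤ t + 1 := by simp
    have q1 : |(X s ω - X t ω - σ * (B s ω - B t ω)) / (s - t)| ≤ K ω := by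
      rw [abs_div, abs_of_pos hs0, div_le_iff₀ hs0]
      exact abs_drift_increment_le h1 h3 hts.le fun u hu ↦ Kb u (hu.trans hs)
    have q2 : |(Y s ω - Y t ω - τ * (W s ω - W t ω)) / (s - t)| ≤ K ω := by
      rw [abs_div, abs_of_pos hs0, div_le_iff₀ hs0]
      exact abs_drift_increment_le h2 h4 hts.le fun u hu ↦ Kc u (hu.trans hs)
    have q3 : |X t ω + σ * (B s ω - B t ω)| ≤ (1 + 2 * |σ|) * K ω := by
      calc |X t ω + σ * (B s ω - B t ω)| ≤ |X t ω| + |σ| * (|B s ω| + |B t ω|) := by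
            refine (abs_add_le _ _).trans ?_
            rw [abs_mul]
            gcongr
            exact abs_sub _ _
        _ ≤ K ω + |σ| * (K ω + K ω) := by
            gcongr
            exacts [KX t t1, KB s hs, KB t t1]
        _ = _ := by ring
    have q4 : |X s ω + (X t ω + σ * (B s ω - B t ω))| ≤ (2 + 2 * |σ|) * K ω :=
      (abs_add_le _ _).trans (by linarith [KX s hs])
    rw [split, Real.norm_eq_abs, Real.norm_of_nonneg K0]
    refine (abs_add_le _ _).trans ?_
    rw [abs_mul, abs_mul, abs_mul, abs_pow]
    calc _ ≤ K ω * ((2 + 2 * |σ|) * K ω) * K ω + ((1 + 2 * |σ|) * K ω) ^ 2 * K ω := by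
          gcongr
          exact KY s hs
      _ = _ := by ring
  · exact (mK.integrable_norm_pow (by norm_num)).const_mul _
  · filter_upwards [hX.drift_cont, hY.drift_cont, hX.eqn, hY.eqn, hX.cont, hY.cont, rB.cont]
      with ω h1 h2 h3 h4 h5 h6 h7
    simp_rw [split]
    have lX : Tendsto (fun s ↦ X s ω) (𝓝[>] t) (𝓝 (X t ω)) :=
      (h5.tendsto t).mono_left nhdsWithin_le_nhds
    have lY : Tendsto (fun s ↦ Y s ω) (𝓝[>] t) (𝓝 (Y t ω)) :=
      (h6.tendsto t).mono_left nhdsWithin_le_nhds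
    have lB : Tendsto (fun s ↦ X t ω + σ * (B s ω - B t ω)) (𝓝[>] t) (𝓝 (X t ω)) := by
      have := (((h7.tendsto t).mono_left (nhdsWithin_le_nhds (s := Set.Ioi t))).sub_const
        (B t ω)).const_mul σ |>.const_add (X t ω)
      simpa using this
    have l1 := tendsto_drift_increment_div h1 h3 t
    have l2 := tendsto_drift_increment_div h2 h4 t
    have := ((l1.mul (lX.add lB)).mul lY).add ((lB.pow 2).mul l2)
    convert this using 2
    ring

theorem tendsto_integral_sq_mul_slope (hBW : IsCorrelatedBrownianPair ρ B W P)
    (hX : IsAdditiveNoiseSolution x₀ b σ B X P) (hY : IsAdditiveNoiseSolution y₀ c τ W Y P)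
    (rX : RegularProcess (fun _ ↦ (id : Ω → Ω)) X P)
    (rY : RegularProcess (fun _ ↦ (id : Ω → Ω)) Y P)
    (rb : RegularProcess (fun _ ↦ (id : Ω → Ω)) b P)
    (rc : RegularProcess (fun _ ↦ (id : Ω → Ω)) c P)
    (rB : RegularProcess (fun _ ↦ (id : Ω → Ω)) B P)
    (rW : RegularProcess (fun _ ↦ (id : Ω → Ω)) W P)
    (pX : RegularProcess (pastPair B W) X P) (pY : RegularProcess (pastPair B W) Y P) (t : ℝ≥0) :
    Tendsto (fun s : ℝ≥0 ↦ ((∫ ω, X s ω ^ 2 * Y s ω ∂P) - ∫ ω, X t ω ^ 2 * Y t ω ∂P) / (s - t))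
      (𝓝[>] t)
      (𝓝 ((∫ ω, 2 * (X t ω * Y t ω * b t ω) + X t ω ^ 2 * c t ω ∂P) +
        (σ ^ 2 * (∫ ω, Y t ω ∂P) + 2 * σ * τ * ρ * ∫ ω, X t ω ∂P))) := by
  have := hBW.gaussian.isProbabilityMeasure
  obtain ⟨C, hC⟩ := hBW.exists_abs_integral_increment_sq_mul_le
  have l1 := tendsto_integral_drift_part hX hY rX rY rb rc rB rW t
  have l2 : Tendsto (fun s : ℝ≥0 ↦
      σ ^ 2 * τ * ((∫ ω, (B s ω - B t ω) ^ 2 * (W s ω - W t ω) ∂P) / (s - t))) (𝓝[>] t) (𝓝 0) := by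
    rw [← mul_zero (σ ^ 2 * τ)]
    refine Tendsto.const_mul _ (squeeze_zero_norm' (a := fun s : ℝ≥0 ↦ C * √(s - t)) ?_ ?_)
    · filter_upwards [self_mem_nhdsWithin] with s (hs : t < s)
      obtain ⟨h, rfl⟩ := exists_add_of_le hs.le
      have hh : 0 < h := by simpa using hs
      rw [Real.norm_eq_abs, abs_div, NNReal.coe_add, add_sub_cancel_left,
        abs_of_nonneg h.coe_nonneg, div_le_iff₀ (by exact_mod_cast hh)]
      exact hC t h hh
    · have : Continuous fun s : ℝ≥0 ↦ C * √((s : ℝ) - t) := by fun_prop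
      have := (this.tendsto t).mono_left (nhdsWithin_le_nhds (s := Set.Ioi t))
      simpa using this
  have l := (l1.add_const (σ ^ 2 * (∫ ω, Y t ω ∂P) + 2 * σ * τ * ρ * ∫ ω, X t ω ∂P)).add l2
  rw [add_zero] at l
  refine l.congr' ?_
  filter_upwards [self_mem_nhdsWithin] with s (hs : t < s)
  obtain ⟨h, rfl⟩ := exists_add_of_le hs.le
  have hh : (h : ℝ) ≠ 0 := by
    have : 0 < h := by simpa using hs
    exact_mod_cast this.ne'
  have key := integral_sq_mul_add_noise (σ := σ) (τ := τ) hBW h (pX.adapted t t le_rfl)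
    (pY.adapted t t le_rfl) (rX.memLp t) (rY.memLp t)
  have i1 : Integrable (fun ω ↦ X (t + h) ω ^ 2 * Y (t + h) ω) P :=
    ((rX.pow 2).mul rY).integrable (t + h)
  have i2 : Integrable (fun ω ↦ (X t ω + σ * (B (t + h) ω - B t ω)) ^ 2 *
      (Y t ω + τ * (W (t + h) ω - W t ω))) P := by
    have mul {f g : Ω → ℝ} (hf : ∀ p : ℕ, MemLp f p P) (hg : ∀ p : ℕ, MemLp g p P) (p : ℕ) :
      MemLp (fun ω ↦ f ω * g ω) p P := (hf _).mul_of_two_mul (hg _)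
    have m1 (p : ℕ) : MemLp (fun ω ↦ X t ω + σ * (B (t + h) ω - B t ω)) p P :=
      (rX.memLp t p).add ((hBW.fst.toIsPreBrownianReal.memLp_sub _ _ p).const_mul σ)
    have m2 (p : ℕ) : MemLp (fun ω ↦ Y t ω + τ * (W (t + h) ω - W t ω)) p P :=
      (rY.memLp t p).add ((hBW.snd.toIsPreBrownianReal.memLp_sub _ _ p).const_mul τ)
    simpa [memLp_one_iff_integrable, pow_two] using mul (mul m1 m1) m2 1
  rw [integral_div, integral_sub i1 i2, key, NNReal.coe_add, add_sub_cancel_left]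
  field_simp
  ring

end Moments

/-! ### Regularity of the sentiment and volatility processes. -/

theorem ProbabilityTheory.IsBrownianReal.regularProcess {Ω E : Type*} {mΩ : MeasurableSpace Ω}
    [MeasurableSpace E] {P : Measure Ω} {W : ℝ≥0 → Ω → ℝ} {ξ : ℝ≥0 → Ω → E}
    (hW : IsBrownianReal W P) (h : ∀ s t, s ≤ t → AEFactorsThrough (ξ t) (W s) P) :
    RegularProcess ξ W P where
  adapted := h
  cont := hW.cont
  moments := hW.exists_memLp_forall_abs_le

namespace IsSentimentVolatility

variable {Ω E : Type*} {mΩ : MeasurableSpace Ω} [MeasurableSpace E] {P : Measure Ω}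
  [IsFiniteMeasure P]
  {lam_s mu_s sigma_s mu_v beta_v gamma_v sigma_v rho_sv S₀ V₀ : ℝ} {Ws Wv S V : ℝ≥0 → Ω → ℝ}
  {ξ : ℝ≥0 → Ω → E}

theorem regularProcess_sentiment
    (h : IsSentimentVolatility lam_s mu_s sigma_s mu_v beta_v gamma_v sigma_v rho_sv S₀ V₀
      Ws Wv S V P) (hW : RegularProcess ξ Ws P) : RegularProcess ξ S P := by
  refine IsAdditiveNoiseSolution.regularProcess (x₀ := S₀) (κ := lam_s) (σ := sigma_s)
    (a := fun _ _ ↦ lam_s * mu_s) ?_ (.const _) hW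
  simpa only [mul_sub] using h.sentiment

theorem regularProcess_volatility
    (h : IsSentimentVolatility lam_s mu_s sigma_s mu_v beta_v gamma_v sigma_v rho_sv S₀ V₀
      Ws Wv S V P) (hS : RegularProcess ξ S P) (hW : RegularProcess ξ Wv P) :
    RegularProcess ξ V P :=
  IsAdditiveNoiseSolution.regularProcess h.volatility
    ((RegularProcess.const mu_v).add (((hS.sub (.const mu_s)).pow 2).const_mul beta_v)) hW

end IsSentimentVolatility

/-! ### The linear differential equation for the moment, and the conclusion. -/

theorem hasDerivWithinAt_comp_toNNReal {m : ℝ≥0 → ℝ} {m' : ℝ} {t : ℝ≥0}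
    (h : Tendsto (fun s : ℝ≥0 ↦ (m s - m t) / (s - t)) (𝓝[>] t) (𝓝 m')) :
    HasDerivWithinAt (fun x : ℝ ↦ m x.toNNReal) m' (Set.Ioi t) t := by
  rw [hasDerivWithinAt_iff_tendsto_slope' (by simp)]
  have hc : Tendsto Real.toNNReal (𝓝[>] (t : ℝ)) (𝓝[>] t) := by
    refine tendsto_nhdsWithin_iff.2 ⟨?_, ?_⟩
    · have := (continuous_real_toNNReal.tendsto (t : ℝ)).mono_left
        (nhdsWithin_le_nhds (s := Set.Ioi (t : ℝ)))
      rwa [Real.toNNReal_coe] at this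
    · filter_upwards [self_mem_nhdsWithin] with x (hx : (t : ℝ) < x)
      exact Real.lt_toNNReal_iff_coe_lt.2 hx
  refine (h.comp hc).congr' ?_
  filter_upwards [self_mem_nhdsWithin] with x (hx : (t : ℝ) < x)
  simp [slope_def_field, Real.coe_toNNReal x (t.coe_nonneg.trans hx.le)]

/-- The moment `m` of a process satisfying `m' = F - k m` is given by variation of constants. -/
theorem eq_exp_mul_add_integral_of_slope {m F : ℝ≥0 → ℝ} {k : ℝ} (hm : Continuous m)
    (hF : Continuous F)
    (h : ∀ t : ℝ≥0, Tendsto (fun s : ℝ≥0 ↦ (m s - m t) / (s - t)) (𝓝[>] t) (𝓝 (F t - k * m t)))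
    (t : ℝ≥0) :
    m t = Real.exp (-k * t) * m 0
      + ∫ u in (0 : ℝ)..t, Real.exp (k * (u - t)) * F u.toNNReal := by
  have hm' : Continuous fun x : ℝ ↦ m x.toNNReal := hm.comp continuous_real_toNNReal
  have hF' : Continuous fun x : ℝ ↦ F x.toNNReal := hF.comp continuous_real_toNNReal
  -- Multiplying by `exp (k * (x - t))` cancels the term `-k m`; for a continuous function, an
  -- integrable right derivative is enough for the fundamental theorem of calculus.
  have key := intervalIntegral.integral_eq_sub_of_hasDeriv_right (a := 0) (b := t)
    (f := fun x : ℝ ↦ Real.exp (k * (x - t)) * m x.toNNReal)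
    (f' := fun x : ℝ ↦ Real.exp (k * (x - t)) * F x.toNNReal)
    (by fun_prop) (fun x hx ↦ ?_) (by apply Continuous.intervalIntegrable; fun_prop)
  · rw [key]
    simp only [Real.toNNReal_coe, sub_self, mul_zero, Real.exp_zero, one_mul, zero_sub,
      Real.toNNReal_zero]
    rw [mul_neg, neg_mul]
    ring
  · rw [min_eq_left t.coe_nonneg] at hx
    lift x to ℝ≥0 using hx.1.le
    have e : HasDerivAt (fun y : ℝ ↦ Real.exp (k * (y - t))) (Real.exp (k * (x - t)) * k) x := by
      simpa using (((hasDerivAt_id (x : ℝ)).sub_const (t : ℝ)).const_mul k).exp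
    refine (e.hasDerivWithinAt.mul (hasDerivWithinAt_comp_toNNReal (h x))).congr_deriv ?_
    simp only [Real.toNNReal_coe]
    ring

theorem mainTheorem6 {Ω : Type*} [MeasurableSpace Ω] (P : Measure Ω) [IsProbabilityMeasure P]
    (lam_s mu_s sigma_s mu_v beta_v gamma_v sigma_v rho_sv S₀ V₀ : ℝ)
    (Ws Wv S V : ℝ≥0 → Ω → ℝ)
    (hSV : IsSentimentVolatility lam_s mu_s sigma_s mu_v beta_v gamma_v sigma_v rho_sv S₀ V₀
      Ws Wv S V P)
    (t : ℝ≥0) :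
    (∀ u : ℝ≥0,
      Integrable (fun ω ↦ S u ω) P ∧ Integrable (fun ω ↦ S u ω ^ 2) P ∧
      Integrable (fun ω ↦ S u ω ^ 3) P ∧ Integrable (fun ω ↦ S u ω ^ 4) P ∧
      Integrable (fun ω ↦ V u ω) P ∧ Integrable (fun ω ↦ S u ω * V u ω) P ∧
      Integrable (fun ω ↦ S u ω ^ 2 * V u ω) P) ∧
    IntervalIntegrable (fun u : ℝ ↦
        Real.exp ((gamma_v + 2 * lam_s) * (u - t)) *
          (2 * sigma_v * sigma_s * rho_sv * (∫ ω, S u.toNNReal ω ∂P)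
            + (mu_v + beta_v * mu_s ^ 2) * (∫ ω, S u.toNNReal ω ^ 2 ∂P)
            - 2 * mu_s * beta_v * (∫ ω, S u.toNNReal ω ^ 3 ∂P)
            + beta_v * (∫ ω, S u.toNNReal ω ^ 4 ∂P)
            + 2 * lam_s * mu_s * (∫ ω, S u.toNNReal ω * V u.toNNReal ω ∂P)
            + sigma_s ^ 2 * (∫ ω, V u.toNNReal ω ∂P)))
      volume 0 t ∧
    (∫ ω, S t ω ^ 2 * V t ω ∂P) =
      Real.exp (-(gamma_v + 2 * lam_s) * t) * (S₀ ^ 2 * V₀)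
        + ∫ u in (0 : ℝ)..t,
            Real.exp ((gamma_v + 2 * lam_s) * (u - t)) *
              (2 * sigma_v * sigma_s * rho_sv * (∫ ω, S u.toNNReal ω ∂P)
                + (mu_v + beta_v * mu_s ^ 2) * (∫ ω, S u.toNNReal ω ^ 2 ∂P)
                - 2 * mu_s * beta_v * (∫ ω, S u.toNNReal ω ^ 3 ∂P)
                + beta_v * (∫ ω, S u.toNNReal ω ^ 4 ∂P)
                + 2 * lam_s * mu_s * (∫ ω, S u.toNNReal ω * V u.toNNReal ω ∂P)
                + sigma_s ^ 2 * (∫ ω, V u.toNNReal ω ∂P)) := by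
  -- Regularity is used with two kinds of information: `id` yields measurability on `Ω`, hence
  -- integrability, while `pastPair` yields independence from later increments.
  have rWs : RegularProcess (fun _ ↦ (id : Ω → Ω)) Ws P := hSV.noise.fst.regularProcess
    fun s _ _ ↦ (hSV.noise.fst.toIsPreBrownianReal.aemeasurable s).aeFactorsThrough_id
  have rWv : RegularProcess (fun _ ↦ (id : Ω → Ω)) Wv P := hSV.noise.snd.regularProcess
    fun s _ _ ↦ (hSV.noise.snd.toIsPreBrownianReal.aemeasurable s).aeFactorsThrough_id
  have pWs : RegularProcess (pastPair Ws Wv) Ws P := hSV.noise.fst.regularProcess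
    fun s t hst ↦ ⟨fun x ↦ x (.inl s), measurable_pi_apply _,
      ae_of_all _ fun ω ↦ by simp [pastPair, min_eq_right hst]⟩
  have pWv : RegularProcess (pastPair Ws Wv) Wv P := hSV.noise.snd.regularProcess
    fun s t hst ↦ ⟨fun x ↦ x (.inr s), measurable_pi_apply _,
      ae_of_all _ fun ω ↦ by simp [pastPair, min_eq_right hst]⟩
  have rS := hSV.regularProcess_sentiment rWs
  have rV := hSV.regularProcess_volatility rS rWv
  have pS := hSV.regularProcess_sentiment pWs
  have pV := hSV.regularProcess_volatility pS pWv
  have rb : RegularProcess (fun _ ↦ (id : Ω → Ω)) (fun t ω ↦ lam_s * (mu_s - S t ω)) P :=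
    ((RegularProcess.const mu_s).sub rS).const_mul lam_s
  have rc : RegularProcess (fun _ ↦ (id : Ω → Ω))
      (fun t ω ↦ mu_v + beta_v * (S t ω - mu_s) ^ 2 - gamma_v * V t ω) P :=
    ((RegularProcess.const mu_v).add (((rS.sub (.const mu_s)).pow 2).const_mul beta_v)).sub
      (rV.const_mul gamma_v)
  have c1 := rS.continuous_integral
  have c2 := (rS.pow 2).continuous_integral
  have c3 := (rS.pow 3).continuous_integral
  have c4 := (rS.pow 4).continuous_integral
  have c5 := rV.continuous_integral
  have c6 := (rS.mul rV).continuous_integral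
  have c7 := ((rS.pow 2).mul rV).continuous_integral
  let F : ℝ≥0 → ℝ := fun u ↦ 2 * sigma_v * sigma_s * rho_sv * (∫ ω, S u ω ∂P)
            + (mu_v + beta_v * mu_s ^ 2) * (∫ ω, S u ω ^ 2 ∂P)
            - 2 * mu_s * beta_v * (∫ ω, S u ω ^ 3 ∂P)
            + beta_v * (∫ ω, S u ω ^ 4 ∂P)
            + 2 * lam_s * mu_s * (∫ ω, S u ω * V u ω ∂P)
            + sigma_s ^ 2 * (∫ ω, V u ω ∂P)
  have hF : Continuous F := by fun_prop
  refine ⟨fun u ↦ ⟨rS.integrable u, (rS.pow 2).integrable u, (rS.pow 3).integrable u,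
    (rS.pow 4).integrable u, rV.integrable u, (rS.mul rV).integrable u,
    ((rS.pow 2).mul rV).integrable u⟩, ?_, ?_⟩
  · have hF' : Continuous fun x : ℝ ↦ F x.toNNReal := hF.comp continuous_real_toNNReal
    have hE : Continuous fun x : ℝ ↦ Real.exp ((gamma_v + 2 * lam_s) * (x - t)) := by fun_prop
    exact (hE.mul hF').intervalIntegrable _ _
  have h0 : ∫ ω, S 0 ω ^ 2 * V 0 ω ∂P = S₀ ^ 2 * V₀ := by
    have : ∀ᵐ ω ∂P, S 0 ω ^ 2 * V 0 ω = S₀ ^ 2 * V₀ := by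
      filter_upwards [hSV.sentiment.eqn, hSV.volatility.eqn,
        hSV.noise.fst.toIsPreBrownianReal.eval_zero_ae_eq_zero,
        hSV.noise.snd.toIsPreBrownianReal.eval_zero_ae_eq_zero] with ω h1 h2 h3 h4
      rw [h1 0, h2 0, h3, h4]
      simp
    simp [integral_congr_ae this]
  rw [← h0]
  refine eq_exp_mul_add_integral_of_slope (F := F) c7 hF (fun t ↦ ?_) t
  have slope := tendsto_integral_sq_mul_slope hSV.noise hSV.sentiment hSV.volatility rS rV rb rc
    rWs rWv pS pV t
  convert slope using 2
  have i2 := ((rS.pow 2).integrable t).const_mul (mu_v + beta_v * mu_s ^ 2)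
  have i3 := ((rS.pow 3).integrable t).const_mul (2 * mu_s * beta_v)
  have i23 : Integrable (fun ω ↦ (mu_v + beta_v * mu_s ^ 2) * S t ω ^ 2
      - 2 * mu_s * beta_v * S t ω ^ 3) P := i2.sub i3
  have i4 := ((rS.pow 4).integrable t).const_mul beta_v
  have i6 := ((rS.mul rV).integrable t).const_mul (2 * lam_s * mu_s)
  have i7 := (((rS.pow 2).mul rV).integrable t).const_mul (gamma_v + 2 * lam_s)
  -- The mean reversions of `S²` and of `V` contribute `-2 * lam_s` and `-gamma_v` times `S² V`:
  -- together they form the damping rate `k`, and the other terms belong to `F`.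
  have expand : ∫ ω, 2 * (S t ω * V t ω * (lam_s * (mu_s - S t ω))) +
        S t ω ^ 2 * (mu_v + beta_v * (S t ω - mu_s) ^ 2 - gamma_v * V t ω) ∂P =
      ∫ ω, (mu_v + beta_v * mu_s ^ 2) * S t ω ^ 2 - 2 * mu_s * beta_v * S t ω ^ 3
        + beta_v * S t ω ^ 4 + 2 * lam_s * mu_s * (S t ω * V t ω)
        - (gamma_v + 2 * lam_s) * (S t ω ^ 2 * V t ω) ∂P :=
    integral_congr_ae (ae_of_all _ fun ω ↦ by ring)
  rw [expand, integral_sub ((i23.fun_add i4).fun_add i6) i7,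
    integral_add (i23.fun_add i4) i6, integral_add i23 i4,
    integral_sub i2 i3]
  simp only [integral_const_mul, F]
  ring
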